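/- Let $d\in\mathbb{N}$ and let $T:\mathbb{Z}^d\curvearrowright(X,\mu)$ be an action by measurable, measure-preserving maps on a measure space (for instance, a probability space), acting on the complex Hilbert space $L^2(X,\mu)$ by $T^vf=f\circ T^v$. Call a homomorphism $\chi:\mathbb{Z}^d\to\{z\in\mathbb{C}:|z|=1\}$ rational if its image is finite, and call $g\in L^2(X,\mu)$ a rational eigenfunction if for some rational $\chi$ we have $T^vg=\chi(v)g$ for all $v\in\mathbb{Z}^d$. Let $P_{\mathbf{Rat}}:L^2(X,\mu)\to L^2(X,\mu)$ be the orthogonal projection onto the rational Kronecker factor, i.e. the norm-closed linear subspace spanned by the rational eigenfunctions. Then for every $f\in L^2(X,\mu)$ and $\epsilon>0$ there is a positive integer $k=k(f,\epsilon)$ such that the following holds for all polynomials $p_1,\dots,p_d\in\mathbb{Z}[n]$ such that no non-trivial $\mathbb{R}$-linear combination of them is constant. Writing $p(n)=(p_1(n),\dots,p_d(n))$, the limit $$Q_pf:=\lim_{N\to\infty}\frac1N\sum_{n=1}^N T^{p(n)}f$$ exists in the norm topology of $L^2(X,\mu)$, and if $p(\mathbb{Z})\subset k\mathbb{Z}^d$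 then $$\left\|Q_pf-P_{\mathbf{Rat}}f\right\|_2<\epsilon.$$ -/

import Mathlib

open MeasureTheory

namespace PolynomialErgodic

noncomputable section

/-- A measure-preserving action `T : ℤ^d ↷ (X, μ)` is given by an additive action of
`Fin d → ℤ` on `X` by measurable maps that preserve `μ`.  This is the induced operator
`T^v f = f ∘ T^v` on the complex Hilbert space `L²(X, μ)`. -/
def koopman {d : ℕ} {X : Type*} [MeasurableSpace X] [AddAction (Fin d → ℤ) X]
    [MeasurableConstVAdd (Fin d → ℤ) X] (μ : Measure X)
    [VAddInvariantMeasure (Fin d → ℤ) X μ] (v : Fin d → ℤ) :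
    Lp ℂ 2 μ →ₗᵢ[ℂ] Lp ℂ 2 μ :=
  Lp.compMeasurePreservingₗᵢ ℂ (fun x : X => v +ᵥ x) (measurePreserving_vadd v μ)

/-- A character of `ℤ^d` is rational if its image is finite. -/
def IsRationalChar {d : ℕ} (χ : AddChar (Fin d → ℤ) Circle) : Prop :=
  (Set.range χ).Finite

/-- `f ∈ L²(X, μ)` is a `χ`-eigenfunction if `T^v f = χ(v) f` for all `v ∈ ℤ^d`. -/
def IsEigenfunction {d : ℕ} {X : Type*} [MeasurableSpace X] [AddAction (Fin d → ℤ) X]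
    [MeasurableConstVAdd (Fin d → ℤ) X] (μ : Measure X)
    [VAddInvariantMeasure (Fin d → ℤ) X μ] (χ : AddChar (Fin d → ℤ) Circle)
    (f : Lp ℂ 2 μ) : Prop :=
  ∀ v : Fin d → ℤ, koopman μ v f = (χ v : ℂ) • f

/-- The rational Kronecker factor: the closed linear span in `L²(X, μ)` of the rational
eigenfunctions of the action of `ℤ^d`. -/
def ratKronecker (d : ℕ) {X : Type*} [MeasurableSpace X] [AddAction (Fin d → ℤ) X]
    [MeasurableConstVAdd (Fin d → ℤ) X] (μ : Measure X)
    [VAddInvariantMeasure (Fin d → ℤ) X μ] : Submodule ℂ (Lp ℂ 2 μ) :=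
  (Submodule.span ℂ {f : Lp ℂ 2 μ | ∃ χ : AddChar (Fin d → ℤ) Circle,
    IsRationalChar χ ∧ IsEigenfunction μ χ f}).topologicalClosure

instance ratKronecker_hasOrthogonalProjection (d : ℕ) {X : Type*} [MeasurableSpace X]
    [AddAction (Fin d → ℤ) X] [MeasurableConstVAdd (Fin d → ℤ) X] (μ : Measure X)
    [VAddInvariantMeasure (Fin d → ℤ) X μ] : (ratKronecker d μ).HasOrthogonalProjection := by
  unfold ratKronecker
  infer_instance

/-- The orthogonal projection onto the rational Kronecker factor, as an operator
on `L²(X, μ)`. -/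
def projRat (d : ℕ) {X : Type*} [MeasurableSpace X] [AddAction (Fin d → ℤ) X]
    [MeasurableConstVAdd (Fin d → ℤ) X] (μ : Measure X)
    [VAddInvariantMeasure (Fin d → ℤ) X μ] : Lp ℂ 2 μ →L[ℂ] Lp ℂ 2 μ :=
  (ratKronecker d μ).starProjection

/-- The map `ℤ → ℤ^d`, `n ↦ (p₁(n), …, p_d(n))`. -/
def polyMap {d : ℕ} (p : Fin d → Polynomial ℤ) (n : ℤ) : Fin d → ℤ :=
  fun i => (p i).eval n

/-- No non-trivial `ℝ`-linear combination of `p₁, …, p_d` is constant. -/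
def NoConstantCombination {d : ℕ} (p : Fin d → Polynomial ℤ) : Prop :=
  ∀ c : Fin d → ℝ, c ≠ 0 → ∀ b : ℝ,
    ∑ i, c i • (p i).map (Int.castRingHom ℝ) ≠ Polynomial.C b

/-- The average `(1/N) ∑_{n=1}^N T^{p(n)} f`. -/
def polyAverage {d : ℕ} {X : Type*} [MeasurableSpace X] [AddAction (Fin d → ℤ) X]
    [MeasurableConstVAdd (Fin d → ℤ) X] (μ : Measure X)
    [VAddInvariantMeasure (Fin d → ℤ) X μ] (p : Fin d → Polynomial ℤ) (f : Lp ℂ 2 μ)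
    (N : ℕ) : Lp ℂ 2 μ :=
  (1 / (N : ℂ)) • ∑ n ∈ Finset.Icc 1 N, koopman μ (polyMap p (n : ℤ)) f

end

end PolynomialErgodic

/-! Split `f = f₁ + (f - f₁)` with `f₁` the projection to the rational Kronecker factor.

The vector `f₁` is a limit of vectors `g` fixed by some `M ℤ^d`. For these, `n ↦ T^{p(n)} g` is
periodic modulo `M`, so its averages converge, and by approximation so do those of `f₁`. Choose `k`
as a period of a single `g` within `ε/3` of `f₁`; this precedes the choice of `p`. If `p` takes
values in `k ℤ^d`, then `T^{p(n)}` fixes `g`, and each `T^{p(n)} f₁` is within `2ε/3` of `f₁`.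

The averages of `f - f₁` tend to zero, because this vector is orthogonal to all periodic vectors
(`mem_ratKronecker_of_periodic`). This is `tendsto_cesaro_polyMap_of_orthogonal_periodic`, by
induction on the degree. Let `a` be the leading coefficient vector. The component orthogonal to all
vectors fixed by a positive multiple of `a` is handled by van der Corput differencing down to the
mean ergodic theorem. On a vector fixed by `M • a`, the leading term acts as a constant translation
along each residue class modulo `M`, so it can be dropped. The remaining polynomial may become
degenerate, but only in directions seen by the stabilizer of the vector, which has gained `M • a`.
Hence the induction assumes non-degeneracy only for functionals vanishing on the stabilizer. In
degree zero the stabilizer has finite index, so the vector is periodic, hence orthogonal to itself.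
-/

namespace PolynomialErgodic

open Filter Topology Polynomial

/-! ### Cesàro averages: approximation, shifts and residue classes. -/

section Cesaro

variable {E : Type*} [NormedAddCommGroup E] [NormedSpace ℂ E]

/-- The Cesàro average `(1/N) ∑_{n < N} u n`. -/
noncomputable def cesaro (u : ℕ → E) (N : ℕ) : E :=
  (N : ℂ)⁻¹ • ∑ n ∈ Finset.range N, u n

lemma cesaro_add (u v : ℕ → E) (N : ℕ) :
    cesaro (fun n => u n + v n) N = cesaro u N + cesaro v N := by
  simp [cesaro, Finset.sum_add_distrib]

lemma cesaro_sub (u v : ℕ → E) (N : ℕ) :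
    cesaro (fun n => u n - v n) N = cesaro u N - cesaro v N := by
  simp [cesaro, Finset.sum_sub_distrib, smul_sub]

lemma cesaro_sum {ι : Type*} (s : Finset ι) (u : ι → ℕ → E) (N : ℕ) :
    cesaro (fun n => ∑ i ∈ s, u i n) N = ∑ i ∈ s, cesaro (u i) N := by
  simp only [cesaro]
  rw [Finset.sum_comm, Finset.smul_sum]

lemma map_cesaro {F : Type*} [NormedAddCommGroup F] [NormedSpace ℂ F] (L : E →L[ℂ] F)
    (u : ℕ → E) (N : ℕ) : L (cesaro u N) = cesaro (fun n => L (u n)) N := by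
  simp [cesaro]

lemma norm_cesaro_le {u : ℕ → E} {C : ℝ} (hu : ∀ n, ‖u n‖ ≤ C) (N : ℕ) : ‖cesaro u N‖ ≤ C := by
  have hC : 0 ≤ C := (norm_nonneg _).trans (hu 0)
  rcases Nat.eq_zero_or_pos N with rfl | hN
  · simpa [cesaro] using hC
  have hN' : (0 : ℝ) < N := by exact_mod_cast hN
  rw [cesaro, norm_smul, norm_inv, Complex.norm_natCast, inv_mul_le_iff₀ hN']
  calc ‖∑ n ∈ Finset.range N, u n‖ ≤ ∑ n ∈ Finset.range N, C :=
        norm_sum_le_of_le _ fun n _ => hu n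
    _ = N * C := by simp

lemma cesaro_const (x : E) {N : ℕ} (hN : 0 < N) : cesaro (fun _ => x) N = x := by
  have : (N : ℂ) ≠ 0 := by exact_mod_cast hN.ne'
  simp [cesaro, ← Nat.cast_smul_eq_nsmul ℂ, smul_smul, this]

lemma tendsto_cesaro_const (x : E) : Tendsto (cesaro fun _ => x) atTop (𝓝 x) :=
  tendsto_const_nhds.congr' <| (eventually_gt_atTop 0).mono fun _ hN => (cesaro_const x hN).symm

lemma tendsto_cesaro_zero_of_approx {u : ℕ → E}
    (h : ∀ ε > 0, ∃ v : ℕ → E, (∀ n, ‖u n - v n‖ ≤ ε) ∧ Tendsto (cesaro v) atTop (𝓝 0)) :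
    Tendsto (cesaro u) atTop (𝓝 0) := by
  rw [Metric.tendsto_atTop]
  intro ε hε
  obtain ⟨v, huv, hv⟩ := h (ε / 2) (by positivity)
  obtain ⟨N₀, hN₀⟩ := Metric.tendsto_atTop.1 hv (ε / 2) (by positivity)
  refine ⟨N₀, fun N hN => ?_⟩
  have h1 := norm_cesaro_le huv N
  have h2 := hN₀ N hN
  rw [cesaro_sub] at h1
  rw [dist_zero_right] at h2 ⊢
  have h3 : cesaro u N = (cesaro u N - cesaro v N) + cesaro v N := by abel
  rw [h3]
  exact (norm_add_le _ _).trans_lt (by linarith)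

lemma exists_tendsto_cesaro_of_approx [CompleteSpace E] {u : ℕ → E}
    (h : ∀ ε > 0, ∃ v : ℕ → E, (∀ n, ‖u n - v n‖ ≤ ε) ∧ ∃ L, Tendsto (cesaro v) atTop (𝓝 L)) :
    ∃ L, Tendsto (cesaro u) atTop (𝓝 L) := by
  apply cauchySeq_tendsto_of_complete
  rw [Metric.cauchySeq_iff]
  intro ε hε
  obtain ⟨v, huv, L, hv⟩ := h (ε / 4) (by positivity)
  obtain ⟨N₀, hN₀⟩ := Metric.cauchySeq_iff.1 hv.cauchySeq (ε / 4) (by positivity)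
  refine ⟨N₀, fun m hm n hn => ?_⟩
  have h1 := norm_cesaro_le huv m
  have h2 := norm_cesaro_le huv n
  have h3 := hN₀ m hm n hn
  rw [cesaro_sub, ← dist_eq_norm] at h1 h2
  have h4 := dist_triangle4 (cesaro u m) (cesaro v m) (cesaro v n) (cesaro u n)
  rw [dist_comm (cesaro v n)] at h4
  linarith

lemma tendsto_inv_natCast_smul_of_norm_le {b : ℕ → E} {C : ℝ} (hb : ∀ n, ‖b n‖ ≤ C) :
    Tendsto (fun N : ℕ => (N : ℂ)⁻¹ • b N) atTop (𝓝 0) := by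
  apply squeeze_zero_norm (a := fun N : ℕ => C / N)
  · intro N
    rw [norm_smul, norm_inv, Complex.norm_natCast, inv_mul_eq_div]
    gcongr
    exact hb N
  · exact tendsto_const_div_atTop_nhds_zero_nat C

/-- Each unit shift changes the sum by two boundary terms, by telescoping. -/
lemma tendsto_cesaro_shift_sub {u : ℕ → E} {C : ℝ} (hu : ∀ n, ‖u n‖ ≤ C) (h : ℕ) :
    Tendsto (fun N => cesaro (fun n => u (n + h)) N - cesaro u N) atTop (𝓝 0) := by
  induction h with
  | zero => simp
  | succ h ih =>
    have key : Tendsto (fun N : ℕ => (N : ℂ)⁻¹ • (u (N + h) - u h)) atTop (𝓝 0) := by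
      refine tendsto_inv_natCast_smul_of_norm_le (C := C + C)
        (b := fun N => u (N + h) - u h) fun n => ?_
      exact (norm_sub_le _ _).trans (add_le_add (hu _) (hu _))
    have := key.add ih
    rw [add_zero] at this
    refine this.congr fun N => ?_
    have e := Finset.sum_range_sub (fun n => u (n + h)) N
    rw [Finset.sum_sub_distrib, zero_add] at e
    rw [← e, smul_sub]
    simp only [cesaro, Nat.add_right_comm _ 1 h]
    simp only [add_assoc]
    abel

lemma sum_range_mul_eq_sum_residues {A : Type*} [AddCommMonoid A] (u : ℕ → A) (M N : ℕ) :
    ∑ n ∈ Finset.range (M * N), u n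
      = ∑ r ∈ Finset.range M, ∑ q ∈ Finset.range N, u (M * q + r) := by
  induction N with
  | zero => simp
  | succ N ih =>
    rw [Nat.mul_succ, Finset.sum_range_add, ih, ← Finset.sum_add_distrib]
    exact Finset.sum_congr rfl fun r _ => (Finset.sum_range_succ _ _).symm

/-- If the Cesàro averages of a bounded sequence converge along every residue class modulo `M`,
then they converge to the mean of these limits. -/
lemma tendsto_cesaro_of_residues {u : ℕ → E} {C : ℝ} (hu : ∀ n, ‖u n‖ ≤ C) {M : ℕ} (hM : 0 < M)
    {L : ℕ → E} (hL : ∀ r < M, Tendsto (cesaro fun q => u (M * q + r)) atTop (𝓝 (L r))) :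
    Tendsto (cesaro u) atTop (𝓝 ((M : ℂ)⁻¹ • ∑ r ∈ Finset.range M, L r)) := by
  have hC : 0 ≤ C := (norm_nonneg _).trans (hu 0)
  have hdiv : Tendsto (fun N : ℕ => N / M) atTop atTop := Nat.tendsto_div_const_atTop hM.ne'
  have h1 : Tendsto (fun N : ℕ => ∑ r ∈ Finset.range M, cesaro (fun q => u (M * q + r)) (N / M))
      atTop (𝓝 (∑ r ∈ Finset.range M, L r)) :=
    tendsto_finsetSum _ fun r hr => (hL r (Finset.mem_range.1 hr)).comp hdiv
  have h2 : Tendsto (fun N : ℕ => ((N / M : ℕ) : ℂ) / N) atTop (𝓝 ((M : ℂ)⁻¹)) := by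
    have hr : Tendsto (fun N : ℕ => ((N / M : ℕ) : ℝ) / N) atTop (𝓝 ((M : ℝ)⁻¹)) := by
      have hM' : (0 : ℝ) < M := by exact_mod_cast hM
      have a : Tendsto (fun N : ℕ => (N : ℝ) / M) atTop atTop :=
        tendsto_natCast_atTop_atTop.atTop_div_const hM'
      have b := (tendsto_nat_floor_div_atTop (R := ℝ)).comp a
      have c := b.mul_const ((M : ℝ)⁻¹)
      rw [one_mul] at c
      refine c.congr fun N => ?_
      simp only [Function.comp_apply, Nat.floor_div_eq_div]
      field_simp
    have := (Complex.continuous_ofReal.tendsto _).comp hr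
    simpa [Function.comp_def] using this
  -- The incomplete last block has fewer than `M` terms, hence is negligible.
  have h3 : Tendsto (fun N : ℕ => (N : ℂ)⁻¹ • ∑ n ∈ Finset.range (N % M), u (M * (N / M) + n))
      atTop (𝓝 0) := by
    refine tendsto_inv_natCast_smul_of_norm_le (C := M * C)
      (b := fun N => ∑ n ∈ Finset.range (N % M), u (M * (N / M) + n)) fun N => ?_
    calc ‖∑ n ∈ Finset.range (N % M), u (M * (N / M) + n)‖
        ≤ ∑ n ∈ Finset.range (N % M), C := norm_sum_le_of_le _ fun n _ => hu _
      _ = (N % M : ℕ) * C := by simp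
      _ ≤ M * C := by
        gcongr
        exact (Nat.mod_lt N hM).le
  have h4 := (h2.smul h1).add h3
  rw [add_zero] at h4
  refine h4.congr' ?_
  filter_upwards [eventually_ge_atTop M] with N hN
  have hq : ((N / M : ℕ) : ℂ) ≠ 0 := by exact_mod_cast (Nat.div_pos hN hM).ne'
  have e : ∑ n ∈ Finset.range N, u n = ∑ r ∈ Finset.range M, ∑ q ∈ Finset.range (N / M),
      u (M * q + r) + ∑ n ∈ Finset.range (N % M), u (M * (N / M) + n) := by
    conv_lhs => rw [← Nat.div_add_mod N M]
    rw [Finset.sum_range_add, sum_range_mul_eq_sum_residues]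
  simp only [cesaro]
  rw [e, smul_add, ← Finset.smul_sum, smul_smul]
  congr 2
  field_simp

lemma exists_tendsto_cesaro_of_periodic {u : ℕ → E} {M : ℕ} (hM : 0 < M)
    (hu : ∀ n, u (n + M) = u n) : ∃ L, Tendsto (cesaro u) atTop (𝓝 L) := by
  have hper : Function.Periodic u M := hu
  refine ⟨_, tendsto_cesaro_of_residues (C := ∑ r ∈ Finset.range M, ‖u r‖) (L := u)
    (fun n => ?_) hM fun r _ => ?_⟩
  · rw [← hper.map_mod_nat n]
    exact Finset.single_le_sum (f := fun r => ‖u r‖) (fun _ _ => norm_nonneg _)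
      (Finset.mem_range.2 (Nat.mod_lt n hM))
  · have : (fun q => u (M * q + r)) = fun _ => u r := by
      ext q
      rw [← hper.map_mod_nat, Nat.mul_add_mod, hper.map_mod_nat]
    rw [this]
    exact tendsto_cesaro_const _

end Cesaro

/-! ### Van der Corput's inequality. -/

section VanDerCorput

variable {E : Type*} [NormedAddCommGroup E] [InnerProductSpace ℂ E]

lemma norm_cesaro_sq_le (w : ℕ → E) (N : ℕ) :
    ‖cesaro w N‖ ^ 2 ≤ (cesaro (fun n => inner ℂ (w n) (w n)) N).re := by
  rcases Nat.eq_zero_or_pos N with rfl | hN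
  · simp [cesaro]
  have hN' : (0 : ℝ) < N := by exact_mod_cast hN
  have e : cesaro (fun n => inner ℂ (w n) (w n)) N
      = (((N : ℝ)⁻¹ * ∑ n ∈ Finset.range N, ‖w n‖ ^ 2 : ℝ) : ℂ) := by
    simp [cesaro, inner_self_eq_norm_sq_to_K]
  rw [e, Complex.ofReal_re, cesaro, norm_smul, norm_inv, Complex.norm_natCast, mul_pow]
  have h1 : ‖∑ n ∈ Finset.range N, w n‖ ^ 2 ≤ N * ∑ n ∈ Finset.range N, ‖w n‖ ^ 2 := by
    calc ‖∑ n ∈ Finset.range N, w n‖ ^ 2 ≤ (∑ n ∈ Finset.range N, ‖w n‖) ^ 2 := by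
          gcongr
          exact norm_sum_le _ _
      _ ≤ N * ∑ n ∈ Finset.range N, ‖w n‖ ^ 2 := by
          simpa using sq_sum_le_card_mul_sum_sq (s := Finset.range N) (f := fun n => ‖w n‖)
  calc ((N : ℝ)⁻¹) ^ 2 * ‖∑ n ∈ Finset.range N, w n‖ ^ 2
      ≤ ((N : ℝ)⁻¹) ^ 2 * (N * ∑ n ∈ Finset.range N, ‖w n‖ ^ 2) := by gcongr
    _ = _ := by field_simp

/-- **Van der Corput's lemma** for bounded sequences in an inner product space. -/
theorem tendsto_cesaro_zero_of_vanDerCorput {u : ℕ → E} {C : ℝ} (hu : ∀ n, ‖u n‖ ≤ C)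
    (h : ∀ k, 0 < k → Tendsto (cesaro fun n => inner ℂ (u (n + k)) (u n)) atTop (𝓝 0)) :
    Tendsto (cesaro u) atTop (𝓝 0) := by
  have hC : 0 ≤ C := (norm_nonneg _).trans (hu 0)
  have hin : ∀ m n, ‖inner ℂ (u m) (u n)‖ ≤ C * C := fun m n =>
    (norm_inner_le_norm _ _).trans (mul_le_mul (hu m) (hu n) (norm_nonneg _) hC)
  have shift : ∀ k l, Tendsto (cesaro fun n => inner ℂ (u (n + k)) (u n)) atTop (𝓝 0) →
      Tendsto (cesaro fun n => inner ℂ (u (n + l + k)) (u (n + l))) atTop (𝓝 0) := by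
    intro k l hk
    have := (tendsto_cesaro_shift_sub (u := fun n => inner ℂ (u (n + k)) (u n))
      (fun n => hin _ _) l).add hk
    simpa using this
  have off : ∀ k l, k ≠ l →
      Tendsto (fun N => (cesaro (fun n => inner ℂ (u (n + k)) (u (n + l))) N).re)
        atTop (𝓝 0) := by
    have gt : ∀ k l, l < k →
        Tendsto (fun N => (cesaro (fun n => inner ℂ (u (n + k)) (u (n + l))) N).re)
          atTop (𝓝 0) := by
      intro k l hlk
      have := (Complex.continuous_re.tendsto _).comp (shift (k - l) l (h _ (by omega)))
      simpa [Function.comp_def, add_assoc, Nat.add_sub_cancel' hlk.le] using this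
    intro k l hkl
    rcases lt_or_gt_of_ne hkl with hlt | hgt
    · refine (gt l k hlt).congr fun N => ?_
      have : cesaro (fun n => inner ℂ (u (n + k)) (u (n + l))) N
          = (starRingEnd ℂ) (cesaro (fun n => inner ℂ (u (n + l)) (u (n + k))) N) := by
        simp [cesaro, map_sum]
      rw [this, Complex.conj_re]
    · exact gt k l hgt
  rw [Metric.tendsto_atTop]
  intro ε hε
  -- Compare `H` times the average of `u` with the average of the window sums `w`. The diagonal
  -- correlations contribute at most `H * C ^ 2`, and this `H` makes that at most half of `(H * (ε /
  -- 2)) ^ 2`; the off-diagonal ones tend to zero.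
  obtain ⟨H, hH⟩ := exists_nat_gt (8 * C ^ 2 / ε ^ 2)
  have hH0 : (0 : ℝ) < H := lt_of_le_of_lt (by positivity) hH
  set w : ℕ → E := fun n => ∑ k ∈ Finset.range H, u (n + k) with hw
  have h1 : Tendsto (fun N => cesaro w N - (H : ℂ) • cesaro u N) atTop (𝓝 0) := by
    have := tendsto_finsetSum (Finset.range H) fun k _ => tendsto_cesaro_shift_sub hu k
    simp only [Finset.sum_const_zero] at this
    refine this.congr fun N => ?_
    rw [Finset.sum_sub_distrib, hw, cesaro_sum]
    simp [← Nat.cast_smul_eq_nsmul ℂ]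
  have h2 : Tendsto (fun N => ∑ k ∈ Finset.range H, ∑ l ∈ (Finset.range H).erase k,
      (cesaro (fun n => inner ℂ (u (n + k)) (u (n + l))) N).re) atTop (𝓝 0) := by
    have := tendsto_finsetSum (Finset.range H) fun k _ =>
      tendsto_finsetSum ((Finset.range H).erase k) fun l hl =>
        off k l (Finset.ne_of_mem_erase hl).symm
    simpa using this
  have h3 : ∀ N, ‖cesaro w N‖ ^ 2 ≤ H * C ^ 2 + ∑ k ∈ Finset.range H,
      ∑ l ∈ (Finset.range H).erase k,
        (cesaro (fun n => inner ℂ (u (n + k)) (u (n + l))) N).re := by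
    intro N
    refine (norm_cesaro_sq_le w N).trans ?_
    have e : cesaro (fun n => inner ℂ (w n) (w n)) N = ∑ k ∈ Finset.range H,
        ∑ l ∈ Finset.range H, cesaro (fun n => inner ℂ (u (n + k)) (u (n + l))) N := by
      simp only [hw, sum_inner, inner_sum, cesaro_sum]
      exact Finset.sum_comm
    have e' : (H : ℝ) * C ^ 2 = ∑ k ∈ Finset.range H, C * C := by simp [sq]
    rw [e, e', ← Finset.sum_add_distrib, Complex.re_sum]
    refine Finset.sum_le_sum fun k hk => ?_
    rw [Complex.re_sum, ← Finset.add_sum_erase _ _ hk]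
    gcongr
    exact (Complex.re_le_norm _).trans (norm_cesaro_le (fun n => hin _ _) N)
  obtain ⟨N₁, hN₁⟩ := Metric.tendsto_atTop.1 h1 (H * (ε / 2)) (by positivity)
  obtain ⟨N₂, hN₂⟩ := Metric.tendsto_atTop.1 h2 (1 / 8 * H ^ 2 * ε ^ 2) (by positivity)
  refine ⟨max N₁ N₂, fun N hN => ?_⟩
  have a1 := hN₁ N (le_of_max_le_left hN)
  have a2 := hN₂ N (le_of_max_le_right hN)
  rw [dist_zero_right] at a1 a2 ⊢
  have a3 := h3 N
  have a4 := lt_of_le_of_lt (le_abs_self _) a2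
  have a5 : H * C ^ 2 ≤ 1 / 8 * (H : ℝ) ^ 2 * ε ^ 2 := by
    rw [div_lt_iff₀ (by positivity)] at hH
    nlinarith [mul_lt_mul_of_pos_left hH hH0]
  have a6 : ‖cesaro w N‖ ^ 2 < (H * (ε / 2)) ^ 2 := by
    nlinarith
  have a7 : ‖cesaro w N‖ < H * (ε / 2) := lt_of_pow_lt_pow_left₀ 2 (by positivity) a6
  have a8 : H * ‖cesaro u N‖ ≤ ‖cesaro w N‖ + ‖cesaro w N - (H : ℂ) • cesaro u N‖ := by
    have : (H : ℂ) • cesaro u N = cesaro w N - (cesaro w N - (H : ℂ) • cesaro u N) := by abel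
    calc H * ‖cesaro u N‖ = ‖(H : ℂ) • cesaro u N‖ := by
          rw [norm_smul, Complex.norm_natCast]
      _ ≤ _ := by
          conv_lhs => rw [this]
          exact norm_sub_le _ _
  nlinarith

end VanDerCorput

/-! ### Differencing, and combinations that are constant. -/

section Polynomials

variable {d : ℕ}

lemma natDegree_taylor_sub_le {q : ℤ[X]} {D : ℕ} (hq : q.natDegree ≤ D + 1) (h : ℤ) :
    (taylor h q - q).natDegree ≤ D := by
  refine natDegree_le_iff_coeff_eq_zero.2 fun N hN => ?_
  rw [coeff_sub]
  rcases (Nat.succ_le_of_lt hN).eq_or_lt with rfl | hlt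
  · rcases hq.eq_or_lt with he | hlt
    · rw [Nat.succ_eq_add_one, ← he, coeff_taylor_natDegree, leadingCoeff, sub_self]
    · rw [coeff_eq_zero_of_natDegree_lt ((natDegree_taylor q h).trans_lt hlt),
        coeff_eq_zero_of_natDegree_lt hlt, sub_self]
  · have := hq.trans_lt hlt
    rw [coeff_eq_zero_of_natDegree_lt ((natDegree_taylor q h).trans_lt this),
      coeff_eq_zero_of_natDegree_lt this, sub_self]

/-- The coefficient of the Taylor shift is the value at `h` of the `D`-th Hasse derivative, which is
affine here. Differencing thus multiplies the leading vector by a nonzero integer when `h ≠ 0`. -/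
lemma coeff_taylor_sub {q : ℤ[X]} {D : ℕ} (hq : q.natDegree ≤ D + 1) (h : ℤ) :
    (taylor h q - q).coeff D = (D + 1) * h * q.coeff (D + 1) := by
  have hdeg : (hasseDeriv D q).natDegree ≤ 1 := by
    refine (natDegree_hasseDeriv_le q D).trans ?_
    omega
  rw [coeff_sub, taylor_coeff, eq_X_add_C_of_natDegree_le_one hdeg]
  simp [hasseDeriv_coeff, Nat.add_comm 1 D]
  ring

/-- The vector of coefficients of `X ^ j` in a tuple of polynomials. -/
def coeffVec (p : Fin d → ℤ[X]) (j : ℕ) : Fin d → ℤ := fun i => (p i).coeff j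

/-- A linear functional whose composition with `p` is constant, in terms of its coordinates `c`. -/
def IsConstantCombination (p : Fin d → ℤ[X]) (c : Fin d → ℝ) : Prop :=
  ∃ b : ℝ, ∑ i, c i • (p i).map (Int.castRingHom ℝ) = C b

/-- Composition with a non-constant affine map preserves the degree. -/
lemma isConstantCombination_of_comp {p : Fin d → ℤ[X]} {c : Fin d → ℝ} {M : ℤ} (hM : M ≠ 0)
    (r : ℤ) (h : IsConstantCombination (fun i => (p i).comp (C M * X + C r)) c) :
    IsConstantCombination p c := by
  obtain ⟨b, hb⟩ := h
  set R : ℝ[X] := ∑ i, c i • (p i).map (Int.castRingHom ℝ) with hR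
  have e : R.comp (C (M : ℝ) * X + C (r : ℝ)) = C b := by
    rw [← hb, hR]
    simp [Polynomial.map_comp, Polynomial.sum_comp]
  have hM' : (M : ℝ) ≠ 0 := by exact_mod_cast hM
  have hd := congrArg natDegree e
  rw [natDegree_comp, natDegree_linear hM', mul_one, natDegree_C] at hd
  exact ⟨R.coeff 0, eq_C_of_natDegree_eq_zero hd⟩

lemma isConstantCombination_of_sub_monomial {p : Fin d → ℤ[X]} {c : Fin d → ℝ} {a : Fin d → ℤ}
    {D : ℕ} (ha : ∑ i, c i * (a i : ℝ) = 0)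
    (h : IsConstantCombination (fun i => p i - C (a i) * X ^ D) c) :
    IsConstantCombination p c := by
  obtain ⟨b, hb⟩ := h
  refine ⟨b, ?_⟩
  rw [← hb]
  have : ∑ i, c i • (C (a i : ℝ) * X ^ D : ℝ[X]) = 0 := by
    have e : ∀ i, c i • (C (a i : ℝ) * X ^ D : ℝ[X]) = C (c i * a i) * X ^ D := fun i => by
      rw [smul_eq_C_mul, C_mul, mul_assoc]
    simp only [e]
    rw [← Finset.sum_mul, ← map_sum, ha, C_0, zero_mul]
  simp only [Polynomial.map_sub, Polynomial.map_mul, Polynomial.map_pow, map_X, map_C, Int.coe_castRingHom,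
    smul_sub, Finset.sum_sub_distrib, this, sub_zero]

lemma natDegree_sub_monomial_le {q : ℤ[X]} {D : ℕ} (hq : q.natDegree ≤ D + 1) :
    (q - C (q.coeff (D + 1)) * X ^ (D + 1)).natDegree ≤ D := by
  refine natDegree_le_iff_coeff_eq_zero.2 fun N hN => ?_
  rw [coeff_sub, coeff_C_mul, coeff_X_pow]
  split_ifs with h
  · simp [h]
  · rw [coeff_eq_zero_of_natDegree_lt (by omega)]
    simp

end Polynomials

/-! ### Subgroups of finite index in `ℤ^d`. -/

section FiniteIndex

variable {d : ℕ}

/-- A subgroup of `ℤ^d` that no nonzero linear functional annihilates contains `K ℤ^d` for some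
`K > 0`. -/
lemma exists_smul_mem_of_no_annihilator (B : AddSubgroup (Fin d → ℤ))
    (hB : ∀ c : Fin d → ℝ, (∀ b ∈ B, ∑ i, c i * (b i : ℝ) = 0) → c = 0) :
    ∃ K : ℕ, 0 < K ∧ ∀ v : Fin d → ℤ, (K : ℤ) • v ∈ B := by
  let castVec : (Fin d → ℤ) → (Fin d → ℚ) := fun b i => b i
  let S : Submodule ℚ (Fin d → ℚ) := Submodule.span ℚ (castVec '' B)
  -- A proper rational span would be killed by a nonzero rational functional, which is in particular
  -- a real one.
  have hS : S = ⊤ := by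
    by_contra hne
    obtain ⟨φ, hφ, hle⟩ := S.exists_le_ker_of_lt_top (lt_top_iff_ne_top.2 hne)
    have hφe : ∀ x : Fin d → ℚ, φ x = ∑ i, φ (Pi.single i 1) * x i := fun x => by
      conv_lhs => rw [← Finset.univ_sum_single x, map_sum]
      refine Finset.sum_congr rfl fun i _ => ?_
      rw [mul_comm, ← smul_eq_mul, ← map_smul, ← Pi.single_smul, smul_eq_mul, mul_one]
    apply hφ
    have hc := hB (fun i => ((φ (Pi.single i 1) : ℚ) : ℝ)) fun b hb => by
      have h0 : φ (castVec b) = 0 := hle (Submodule.subset_span ⟨b, hb, rfl⟩)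
      rw [hφe] at h0
      have := congrArg (fun q : ℚ => (q : ℝ)) h0
      push_cast at this
      simpa [castVec] using this
    ext i
    have := congrFun hc i
    simpa using this
  have key : ∀ x ∈ S, ∃ m : ℕ, 0 < m ∧ ∃ b ∈ B, (m : ℚ) • x = castVec b := by
    intro x hx
    induction hx using Submodule.span_induction with
    | mem x hx =>
      obtain ⟨b, hb, rfl⟩ := hx
      exact ⟨1, one_pos, b, hb, by simp⟩
    | zero => exact ⟨1, one_pos, 0, B.zero_mem, by ext; simp [castVec]⟩
    | add x y _ _ hx hy =>
      obtain ⟨m, hm, b, hb, hmb⟩ := hx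
      obtain ⟨n, hn, b', hb', hnb⟩ := hy
      refine ⟨m * n, Nat.mul_pos hm hn, n • b + m • b',
        B.add_mem (B.nsmul_mem hb _) (B.nsmul_mem hb' _), ?_⟩
      ext i
      have h1 := congrFun hmb i
      have h2 := congrFun hnb i
      simp only [castVec, Pi.smul_apply, smul_eq_mul, Pi.add_apply] at h1 h2 ⊢
      push_cast
      simp only [nsmul_eq_mul]
      push_cast
      rw [← h1, ← h2]
      ring
    | smul q x _ hx =>
      obtain ⟨m, hm, b, hb, hmb⟩ := hx
      refine ⟨q.den * m, Nat.mul_pos q.den_pos hm, q.num • b, B.zsmul_mem hb _, ?_⟩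
      ext i
      have h1 := congrFun hmb i
      simp only [castVec, Pi.smul_apply, smul_eq_mul] at h1 ⊢
      push_cast
      rw [← h1, ← Rat.den_mul_eq_num q]
      ring
  have single : ∀ i : Fin d, ∃ m : ℕ, 0 < m ∧ (m : ℤ) • (Pi.single i 1 : Fin d → ℤ) ∈ B := by
    intro i
    obtain ⟨m, hm, b, hb, hmb⟩ := key (Pi.single i 1) (hS ▸ Submodule.mem_top)
    refine ⟨m, hm, ?_⟩
    convert hb using 1
    ext j
    have := congrFun hmb j
    have h' : ((m : ℤ) • (Pi.single i 1 : Fin d → ℤ)) j = m * if j = i then 1 else 0 := by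
      simp [Pi.single_apply]
    rw [h']
    simp only [castVec, Pi.smul_apply, Pi.single_apply, smul_eq_mul] at this
    exact_mod_cast this
  choose m hm hmB using single
  refine ⟨∏ i, m i, Finset.prod_pos fun i _ => hm i, fun v => ?_⟩
  have e : ((∏ i, m i : ℕ) : ℤ) • v
      = ∑ i, (v i * ((∏ j ∈ Finset.univ.erase i, m j : ℕ) : ℤ)) •
          ((m i : ℤ) • (Pi.single i 1 : Fin d → ℤ)) := by
    ext j
    simp only [Pi.smul_apply, smul_eq_mul, Finset.sum_apply, Pi.single_apply, mul_ite, mul_one,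
      mul_zero, Finset.sum_ite_eq, Finset.mem_univ, if_true]
    rw [← Finset.mul_prod_erase _ _ (Finset.mem_univ j)]
    push_cast
    ring
  rw [e]
  exact B.sum_mem fun i _ => B.zsmul_mem (hmB i) _

end FiniteIndex

/-! ### Polynomial averages for isometric actions on a Hilbert space. -/

section Action

variable {d : ℕ} {H : Type*} [NormedAddCommGroup H] [InnerProductSpace ℂ H]
  {U : (Fin d → ℤ) → H →ₗᵢ[ℂ] H}

/-- `U` is a representation of `ℤ^d` by linear isometries. -/
structure IsIsometricAction (U : (Fin d → ℤ) → H →ₗᵢ[ℂ] H) : Prop where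
  zero_apply : ∀ x, U 0 x = x
  add_apply : ∀ v w x, U (v + w) x = U v (U w x)

namespace IsIsometricAction

lemma comm (hU : IsIsometricAction U) (v w : Fin d → ℤ) (x : H) : U v (U w x) = U w (U v x) := by
  rw [← hU.add_apply, ← hU.add_apply, add_comm]

lemma apply_neg (hU : IsIsometricAction U) (v : Fin d → ℤ) (x : H) : U v (U (-v) x) = x := by
  rw [← hU.add_apply, add_neg_cancel, hU.zero_apply]

lemma inner_apply_left (hU : IsIsometricAction U) (v : Fin d → ℤ) (x y : H) :
    inner ℂ (U v x) y = inner ℂ x (U (-v) y) := by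
  rw [← (U v).inner_map_map x, hU.apply_neg]

lemma inner_apply_apply (hU : IsIsometricAction U) (v w : Fin d → ℤ) (x : H) :
    inner ℂ (U v x) (U w x) = inner ℂ (U (v - w) x) x := by
  rw [← (U w).inner_map_map (U (v - w) x), ← hU.add_apply, add_sub_cancel]

lemma iterate_apply (hU : IsIsometricAction U) (v : Fin d → ℤ) (n : ℕ) (x : H) :
    (U v)^[n] x = U ((n : ℤ) • v) x := by
  induction n with
  | zero => simp [hU.zero_apply]
  | succ n ih =>
    rw [Function.iterate_succ_apply', ih, ← hU.add_apply]
    push_cast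
    rw [add_smul, one_smul, add_comm]

/-- The stabilizer of a vector. -/
def stabilizer (hU : IsIsometricAction U) (x : H) : AddSubgroup (Fin d → ℤ) where
  carrier := {v | U v x = x}
  zero_mem' := hU.zero_apply x
  add_mem' {v w} hv hw := by
    simp only [Set.mem_ofPred_eq] at hv hw ⊢
    rw [hU.add_apply, hw, hv]
  neg_mem' {v} hv := by
    simp only [Set.mem_ofPred_eq] at hv ⊢
    apply (U v).injective
    rw [hU.apply_neg, hv]

end IsIsometricAction

/-- Integer polynomials are periodic modulo `M`, so the orbit sequence is periodic. -/
lemma IsIsometricAction.exists_tendsto_cesaro_polyMap_of_periodic (hU : IsIsometricAction U)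
    (p : Fin d → ℤ[X]) {M : ℕ} (hM : 0 < M) {g : H} (hg : ∀ v, U ((M : ℤ) • v) g = g) :
    ∃ L, Tendsto (cesaro fun n : ℕ => U (polyMap p n) g) atTop (𝓝 L) := by
  refine exists_tendsto_cesaro_of_periodic hM fun n => ?_
  have h : ∀ i, (M : ℤ) ∣ (p i).eval ((n + M : ℕ) : ℤ) - (p i).eval (n : ℤ) := fun i =>
    dvd_trans (by simp) (sub_dvd_eval_sub ((n + M : ℕ) : ℤ) n (p i))
  choose t ht using h
  have e : polyMap p ((n + M : ℕ) : ℤ) = polyMap p n + (M : ℤ) • t := by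
    ext i
    simp only [polyMap, Pi.add_apply, Pi.smul_apply, smul_eq_mul, ← ht i]
    ring
  rw [e, hU.add_apply, hg]

/-- The closed subspace of vectors fixed by the isometry `V`. -/
def fixedSpace (V : H →ₗᵢ[ℂ] H) : Submodule ℂ H :=
  V.toContinuousLinearMap.eqLocus (1 : H →L[ℂ] H)

@[simp]
lemma mem_fixedSpace {V : H →ₗᵢ[ℂ] H} {x : H} : x ∈ fixedSpace V ↔ V x = x := Iff.rfl

variable [CompleteSpace H]

instance (V : H →ₗᵢ[ℂ] H) : (fixedSpace V).HasOrthogonalProjection := by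
  unfold fixedSpace
  infer_instance

/-- The projection to the vectors fixed by one element commutes with the whole action. -/
lemma IsIsometricAction.starProjection_fixedSpace_comm (hU : IsIsometricAction U)
    (v w : Fin d → ℤ) (x : H) :
    (fixedSpace (U w)).starProjection (U v x) = U v ((fixedSpace (U w)).starProjection x) := by
  have hmem : ∀ (v : Fin d → ℤ) {y : H}, y ∈ fixedSpace (U w) → U v y ∈ fixedSpace (U w) := by
    intro v y hy
    rw [mem_fixedSpace] at hy ⊢
    rw [hU.comm, hy]
  refine (Submodule.eq_starProjection_of_mem_of_inner_eq_zero
    (hmem v (Submodule.starProjection_apply_mem _ x)) fun y hy => ?_)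
  rw [← map_sub, hU.inner_apply_left]
  exact Submodule.starProjection_inner_eq_zero x _ (hmem (-v) hy)

/-- Mean ergodic theorem for a vector orthogonal to the invariant vectors. -/
lemma IsIsometricAction.tendsto_cesaro_linear (hU : IsIsometricAction U) (a b : Fin d → ℤ) {f : H}
    (hf : ∀ y, U a y = y → inner ℂ f y = 0) :
    Tendsto (cesaro fun n : ℕ => U ((n : ℤ) • a + b) f) atTop (𝓝 0) := by
  have h1 := (U a).toContinuousLinearMap.tendsto_birkhoffAverage_orthogonalProjection
    (U a).norm_toContinuousLinearMap_le f
  have h2 : (fixedSpace (U a)).orthogonalProjectionOnto f = 0 := by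
    rw [Submodule.orthogonalProjectionOnto_eq_zero_iff, Submodule.mem_orthogonal']
    exact fun y hy => hf y hy
  unfold fixedSpace at h2
  rw [h2] at h1
  have h3 := ((U b).continuous.tendsto _).comp h1
  simp only [ZeroMemClass.coe_zero, map_zero] at h3
  refine h3.congr fun N => ?_
  have e : birkhoffAverage ℂ (U a).toContinuousLinearMap id N f
      = cesaro (fun n : ℕ => U ((n : ℤ) • a) f) N := by
    simp only [birkhoffAverage, birkhoffSum, cesaro, id]
    congr 1
    exact Finset.sum_congr rfl fun n _ => hU.iterate_apply a n f
  simp only [Function.comp_apply, e]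
  have := map_cesaro (U b).toContinuousLinearMap (fun n : ℕ => U ((n : ℤ) • a) f) N
  simp only [LinearIsometry.coe_toContinuousLinearMap] at this
  rw [this]
  simp only [← hU.add_apply, add_comm b]

/-- Averages along a polynomial vanish on the vectors without a component periodic under the
leading coefficient. -/
lemma IsIsometricAction.tendsto_cesaro_polyMap_of_orthogonal_leading (hU : IsIsometricAction U)
    (D : ℕ) {f : H} : ∀ p : Fin d → ℤ[X], (∀ i, (p i).natDegree ≤ D + 1) →
      (∀ M : ℤ, 0 < M → ∀ y, U (M • coeffVec p (D + 1)) y = y → inner ℂ f y = 0) →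
      Tendsto (cesaro fun n : ℕ => U (polyMap p n) f) atTop (𝓝 0) := by
  induction D with
  | zero =>
    intro p hp hf
    have := hU.tendsto_cesaro_linear (coeffVec p 1) (coeffVec p 0) (f := f) fun y hy =>
      hf 1 one_pos y (by simpa using hy)
    convert this using 5 with N n
    ext i
    simp only [polyMap, coeffVec, Pi.add_apply, Pi.smul_apply, smul_eq_mul]
    conv_lhs => rw [eq_X_add_C_of_natDegree_le_one (hp i)]
    simp [mul_comm]
  | succ D ih =>
    intro p hp hf
    refine tendsto_cesaro_zero_of_vanDerCorput (C := ‖f‖)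
      (fun n => ((U _).norm_map f).le) fun k hk => ?_
    have h1 := ih (fun i => taylor (k : ℤ) (p i) - p i)
      -- The differenced polynomial has leading vector `(D + 2) * k` times the old one, so a vector
      -- fixed by `M` times the new leading vector is fixed by `M * ((D + 2) * k)` times the old.
      (fun i => natDegree_taylor_sub_le (hp i) _) fun M hM y hy => by
        refine hf (M * ((D + 2) * k)) (by positivity) y ?_
        have e : coeffVec (fun i => taylor (k : ℤ) (p i) - p i) (D + 1)
            = (((D + 2) * k : ℤ)) • coeffVec p (D + 1 + 1) := by
          ext i
          simp only [coeffVec, Pi.smul_apply, smul_eq_mul]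
          rw [coeff_taylor_sub (hp i)]
          push_cast
          ring
        rwa [e, smul_smul] at hy
    have h2 := (innerSL ℂ f).continuous.tendsto 0 |>.comp h1
    have h3 := (Complex.continuous_conj.tendsto _).comp h2
    simp only [map_zero] at h3
    refine h3.congr fun N => ?_
    simp only [Function.comp_apply]
    rw [map_cesaro]
    simp only [cesaro, hU.inner_apply_apply, smul_eq_mul, map_mul, map_inv₀, map_natCast, map_sum,
      innerSL_apply_apply, inner_conj_symm]
    congr 1
    refine Finset.sum_congr rfl fun n _ => ?_
    congr 2
    congr 1
    ext i
    simp [polyMap, taylor_eval]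


/-- Averages along a polynomial of a vector orthogonal to all periodic vectors vanish, if the
polynomial is non-degenerate modulo the stabilizer of the vector. -/
lemma IsIsometricAction.tendsto_cesaro_polyMap_of_orthogonal_periodic (hU : IsIsometricAction U)
    (D : ℕ) : ∀ (f : H) (p : Fin d → ℤ[X]), (∀ i, (p i).natDegree ≤ D) →
      (∀ M : ℤ, 0 < M → ∀ y, (∀ v, U (M • v) y = y) → inner ℂ f y = 0) →
      (∀ c : Fin d → ℝ, (∀ b, U b f = f → ∑ i, c i * (b i : ℝ) = 0) →
        IsConstantCombination p c → c = 0) →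
      Tendsto (cesaro fun n : ℕ => U (polyMap p n) f) atTop (𝓝 0) := by
  induction D with
  | zero =>
    intro f p hp hf hc
    -- All combinations of constant polynomials are constant, so `hc` says that only `0` annihilates
    -- the stabilizer.
    obtain ⟨K, hK, hKf⟩ := exists_smul_mem_of_no_annihilator (hU.stabilizer f) fun c hcb =>
      hc c hcb ⟨∑ i, c i * (p i).coeff 0, by
        rw [map_sum]
        refine Finset.sum_congr rfl fun i _ => ?_
        rw [eq_C_of_natDegree_le_zero (hp i)]
        simp [smul_eq_C_mul]⟩
    have : f = 0 := inner_self_eq_zero.1 (hf K (by exact_mod_cast hK) f hKf)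
    subst this
    simpa using tendsto_cesaro_const (0 : H)
  | succ D ih =>
    intro f p hp hf hc
    set a := coeffVec p (D + 1) with ha
    -- Factorials make the chain increasing, and every positive `M` divides one of them.
    let F : ℕ → Submodule ℂ H := fun m => fixedSpace (U (((m.factorial : ℕ) : ℤ) • a))
    have hle : ∀ (m n : ℤ), m ∣ n → fixedSpace (U (m • a)) ≤ fixedSpace (U (n • a)) := by
      rintro m _ ⟨k, rfl⟩ y hy
      rw [mul_comm, mul_smul]
      exact (hU.stabilizer y).zsmul_mem hy k
    have hmono : Monotone F := fun m n hmn =>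
      hle _ _ (by exact_mod_cast Nat.factorial_dvd_factorial hmn)
    have hlim := Submodule.starProjection_tendsto_closure_iSup F hmono f
    set K := (⨆ i, F i).topologicalClosure with hK
    have hzero : Tendsto (cesaro fun n : ℕ => U (polyMap p n) (f - K.starProjection f))
        atTop (𝓝 0) := by
      refine hU.tendsto_cesaro_polyMap_of_orthogonal_leading D p hp fun M hM y hy => ?_
      refine Submodule.starProjection_inner_eq_zero f y ?_
      refine Submodule.le_topologicalClosure _ (Submodule.mem_iSup_of_mem M.toNat ?_)
      refine hle M _ ?_ hy
      have := Nat.dvd_factorial (m := M.toNat) (n := M.toNat) (by omega) le_rfl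
      have h' : M = (M.toNat : ℤ) := by omega
      rw [h']
      exact_mod_cast this
    have hproj : ∀ m : ℕ, Tendsto (cesaro fun n : ℕ => U (polyMap p n) ((F m).starProjection f))
        atTop (𝓝 0) := by
      intro m
      set M := m.factorial with hM
      have hM0 : 0 < M := m.factorial_pos
      set g := (F m).starProjection f with hg
      have hgM : U ((M : ℤ) • a) g = g := Submodule.starProjection_apply_mem (F m) f
      have hstab : ∀ b, U b f = f → U b g = g := fun b hb => by
        rw [hg, ← hU.starProjection_fixedSpace_comm, hb]
      have hgperp : ∀ N : ℤ, 0 < N → ∀ y, (∀ v, U (N • v) y = y) → inner ℂ g y = 0 := by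
        intro N hN y hy
        rw [hg, Submodule.inner_starProjection_left_eq_right]
        refine hf N hN _ fun v => ?_
        rw [← hU.starProjection_fixedSpace_comm, hy]
      have hres : ∀ r < M, Tendsto
          (cesaro fun q : ℕ => U (polyMap p ((M * q + r : ℕ) : ℤ)) g) atTop (𝓝 0) := by
        intro r _
        -- Since `(M * q + r) ^ (D + 1) ≡ r ^ (D + 1)` modulo `M` and `M • a` fixes `g`, the leading
        -- term acts on `g` as translation by `w`, independently of `q`.
        set w : Fin d → ℤ := ((r : ℤ) ^ (D + 1)) • a with hw
        set p' : Fin d → ℤ[X] := fun i => p i - C (a i) * X ^ (D + 1) with hp'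
        have hsw : ∀ b, U b g = g → U b (U w g) = U w g := fun b hb => by rw [hU.comm, hb]
        have := ih (U w g) (fun i => (p' i).comp (C (M : ℤ) * X + C (r : ℤ)))
          (fun i => ?_) (fun N hN y hy => ?_) fun c hcb hcc => ?_
        · refine this.congr fun N => ?_
          congr 1
          ext q
          obtain ⟨t, ht⟩ : (M : ℤ) ∣ (M * q + r) ^ (D + 1) - r ^ (D + 1) :=
            dvd_trans (by simp) (sub_dvd_pow_sub_pow ((M : ℤ) * q + r) r (D + 1))
          have e : polyMap p ((M * q + r : ℕ) : ℤ)
              = polyMap (fun i => (p' i).comp (C (M : ℤ) * X + C (r : ℤ))) q + w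
                + t • ((M : ℤ) • a) := by
            ext i
            have : ((M : ℤ) * q + r) ^ (D + 1) = r ^ (D + 1) + M * t := by linarith
            simp only [polyMap, hp', hw, Pi.add_apply, Pi.smul_apply, smul_eq_mul, eval_comp,
              eval_sub, eval_mul, eval_add, eval_C, eval_X, eval_pow, this]
            push_cast
            ring
          rw [e, hU.add_apply,
            show U (t • ((M : ℤ) • a)) g = g from (hU.stabilizer g).zsmul_mem hgM t, hU.add_apply]
        · rw [natDegree_comp]
          refine (Nat.mul_le_mul (natDegree_sub_monomial_le (hp i)) natDegree_linear_le).trans ?_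
          rw [mul_one]
        · rw [hU.inner_apply_left]
          exact hgperp N hN _ fun v => by rw [hU.comm, hy]
        -- The stabilizer of `U w g` contains `M • a`, so `c` kills `a` and does not see the removed
        -- monomial.
        · have hca : ∑ i, c i * (a i : ℝ) = 0 := by
            have := hcb _ (hsw _ hgM)
            have e : ∑ i, c i * ((((M : ℤ) • a) i : ℤ) : ℝ) = M * ∑ i, c i * (a i : ℝ) := by
              rw [Finset.mul_sum]
              refine Finset.sum_congr rfl fun i _ => ?_
              simp only [Pi.smul_apply, smul_eq_mul]
              push_cast
              ring
            rw [e] at this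
            exact (mul_eq_zero.1 this).resolve_left (by exact_mod_cast hM0.ne')
          refine hc c (fun b hb => hcb b (hsw b (hstab b hb))) ?_
          exact isConstantCombination_of_sub_monomial hca
            (isConstantCombination_of_comp (by exact_mod_cast hM0.ne') _ hcc)
      have := tendsto_cesaro_of_residues (u := fun n : ℕ => U (polyMap p n) g) (C := ‖g‖)
        (fun n => ((U _).norm_map g).le) hM0 (L := fun _ => 0) hres
      simpa using this
    have hK0 : Tendsto (cesaro fun n : ℕ => U (polyMap p n) (K.starProjection f))
        atTop (𝓝 0) := by
      refine tendsto_cesaro_zero_of_approx fun ε hε => ?_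
      obtain ⟨m, hm⟩ := (Metric.tendsto_atTop.1 hlim ε hε)
      refine ⟨_, fun n => ?_, hproj m⟩
      rw [← map_sub, LinearIsometry.norm_map, ← dist_eq_norm, dist_comm]
      exact (hm m le_rfl).le
    have := hzero.add hK0
    rw [add_zero] at this
    refine this.congr fun N => ?_
    rw [← cesaro_add]
    simp only [← map_add, sub_add_cancel]

end Action

/-! ### The Koopman representation and the rational Kronecker factor. -/

section Koopman

variable {d : ℕ} {X : Type*} [MeasurableSpace X] [AddAction (Fin d → ℤ) X]
  [MeasurableConstVAdd (Fin d → ℤ) X] (μ : Measure X) [VAddInvariantMeasure (Fin d → ℤ) X μ]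

lemma koopman_coeFn (v : Fin d → ℤ) (f : Lp ℂ 2 μ) :
    koopman μ v f =ᵐ[μ] fun x => f (v +ᵥ x) :=
  Lp.coeFn_compMeasurePreserving f (measurePreserving_vadd v μ)

lemma isIsometricAction_koopman : IsIsometricAction (koopman (d := d) μ) where
  zero_apply f := by
    refine Lp.ext ((koopman_coeFn μ 0 f).trans ?_)
    simp
  add_apply v w f := by
    refine Lp.ext ?_
    have h1 := (measurePreserving_vadd v μ).quasiMeasurePreserving.ae_eq_comp (koopman_coeFn μ w f)
    filter_upwards [koopman_coeFn μ (v + w) f, koopman_coeFn μ v (koopman μ w f), h1]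
      with x h1 h2 h3
    rw [h1, h2]
    simp only [Function.comp_apply] at h3
    rw [h3, vadd_vadd, add_comm]

/-- Vectors invariant under `M ℤ^d` lie in the rational Kronecker factor. -/
lemma mem_ratKronecker_of_periodic {M : ℕ} (hM : 0 < M) {g : Lp ℂ 2 μ}
    (hg : ∀ v : Fin d → ℤ, koopman μ ((M : ℤ) • v) g = g) : g ∈ ratKronecker d μ := by
  classical
  have hU := isIsometricAction_koopman (d := d) μ
  have : NeZero M := ⟨hM.ne'⟩
  let red : (Fin d → ℤ) →+ (Fin d → ZMod M) :=
    { toFun := fun v i => (v i : ZMod M)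
      map_zero' := by ext; simp
      map_add' := fun v w => by ext; simp }
  have hred : Function.Surjective red := fun a => by
    choose v hv using fun i => ZMod.intCast_surjective (a i)
    exact ⟨v, funext hv⟩
  choose lift hlift using hred
  have hcongr : ∀ v w : Fin d → ℤ, red v = red w → koopman μ v g = koopman μ w g := by
    intro v w hvw
    have h : ∀ i, (M : ℤ) ∣ v i - w i := fun i =>
      (ZMod.intCast_eq_intCast_iff_dvd_sub _ _ _).1 (congrFun hvw i).symm
    choose t ht using h
    have e : v = w + (M : ℤ) • t := by
      ext i
      simp only [Pi.add_apply, Pi.smul_apply, smul_eq_mul, ← ht i]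
      ring
    rw [e, hU.add_apply, hg]
  -- Finite Fourier analysis: the orbit of `g` factors through `(ℤ/M)^d`, `comp ψ` is its
  -- `ψ`-isotypic component up to scaling, and these components sum to a multiple of `g`.
  let comp : AddChar (Fin d → ZMod M) ℂ → Lp ℂ 2 μ := fun ψ =>
    ∑ a, ψ (-a) • koopman μ (lift a) g
  have hcomp : ∀ ψ, comp ψ ∈ ratKronecker d μ := by
    intro ψ
    refine Submodule.le_topologicalClosure _ (Submodule.subset_span ?_)
    refine ⟨(AddChar.circleEquivComplex.symm ψ).compAddMonoidHom red, ?_, fun v => ?_⟩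
    · refine (Set.finite_range (AddChar.circleEquivComplex.symm ψ)).subset ?_
      rintro _ ⟨v, rfl⟩
      exact ⟨red v, rfl⟩
    · have e : (((AddChar.circleEquivComplex.symm ψ).compAddMonoidHom red v : Circle) : ℂ)
          = ψ (red v) := rfl
      rw [e]
      simp only [comp, map_sum, map_smul, ← hU.add_apply, Finset.smul_sum, smul_smul]
      refine Fintype.sum_equiv (Equiv.addLeft (red v)) _ _ fun a => ?_
      rw [Equiv.coe_addLeft, ← AddChar.map_add_eq_mul]
      congr 1
      · rw [neg_add, add_neg_cancel_left]
      · exact hcongr _ _ (by rw [map_add, hlift, hlift])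
  have hsum : ∑ ψ, comp ψ = (Fintype.card (Fin d → ZMod M) : ℂ) • g := by
    simp only [comp]
    rw [Finset.sum_comm]
    simp only [← Finset.sum_smul, AddChar.sum_apply_eq_ite, neg_eq_zero, ite_smul, zero_smul,
      Finset.sum_ite_eq', Finset.mem_univ, if_true]
    rw [hcongr (lift 0) 0 (by rw [hlift, map_zero]), hU.zero_apply]
  have hcard : (Fintype.card (Fin d → ZMod M) : ℂ) ≠ 0 := by
    exact_mod_cast Fintype.card_ne_zero
  rw [← inv_smul_smul₀ hcard g, ← hsum]
  exact Submodule.smul_mem _ _ (Submodule.sum_mem _ fun ψ _ => hcomp ψ)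

/-- The image is a finite group; its order serves as `M`, by Lagrange. -/
lemma IsRationalChar.exists_periodic {χ : AddChar (Fin d → ℤ) Circle} (hχ : IsRationalChar χ) :
    ∃ M : ℕ, 0 < M ∧ ∀ v : Fin d → ℤ, χ ((M : ℤ) • v) = 1 := by
  have : Finite χ.toMonoidHom.range := hχ
  refine ⟨Nat.card χ.toMonoidHom.range, Nat.card_pos, fun v => ?_⟩
  have h : (⟨χ v, ⟨Multiplicative.ofAdd v, rfl⟩⟩ : χ.toMonoidHom.range) ^
      Nat.card χ.toMonoidHom.range = 1 := pow_card_eq_one'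
  rw [natCast_zsmul, AddChar.map_nsmul_eq_pow]
  exact congrArg Subtype.val h

/-- Vectors of the rational Kronecker factor are limits of vectors invariant under some
`M ℤ^d`. -/
lemma exists_periodic_near_of_mem_ratKronecker {f : Lp ℂ 2 μ} (hf : f ∈ ratKronecker d μ) {ε : ℝ}
    (hε : 0 < ε) : ∃ M : ℕ, 0 < M ∧ ∃ g : Lp ℂ 2 μ,
      (∀ v : Fin d → ℤ, koopman μ ((M : ℤ) • v) g = g) ∧ ‖f - g‖ < ε := by
  have hU := isIsometricAction_koopman (d := d) μ
  obtain ⟨g, hg, hfg⟩ := Metric.mem_closure_iff.1 hf ε hε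
  rw [dist_eq_norm] at hfg
  have hdvd : ∀ (M N : ℕ) (g : Lp ℂ 2 μ), (∀ v : Fin d → ℤ, koopman μ ((M : ℤ) • v) g = g) →
      ∀ v : Fin d → ℤ, koopman μ (((M * N : ℕ) : ℤ) • v) g = g := fun M N g h v => by
    rw [Nat.cast_mul, mul_smul]
    exact h _
  suffices ∃ M : ℕ, 0 < M ∧ ∀ v : Fin d → ℤ, koopman μ ((M : ℤ) • v) g = g by
    obtain ⟨M, hM, h⟩ := this
    exact ⟨M, hM, g, h, hfg⟩
  clear hfg
  induction hg using Submodule.span_induction with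
  | mem g hg =>
    obtain ⟨χ, hχ, hgχ⟩ := hg
    obtain ⟨M, hM, h⟩ := hχ.exists_periodic
    exact ⟨M, hM, fun v => by rw [hgχ, h, Circle.coe_one, one_smul]⟩
  | zero => exact ⟨1, one_pos, fun v => map_zero _⟩
  | add x y _ _ hx hy =>
    obtain ⟨M, hM, h⟩ := hx
    obtain ⟨N, hN, h'⟩ := hy
    refine ⟨M * N, Nat.mul_pos hM hN, fun v => ?_⟩
    rw [map_add, hdvd M N x h, mul_comm, hdvd N M y h']
  | smul a x _ hx =>
    obtain ⟨M, hM, h⟩ := hx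
    exact ⟨M, hM, fun v => by rw [map_smul, h]⟩

/-- Replacing `p` by `p (X + 1)` moves the summation range from `1, …, N` to `0, …, N - 1`. -/
lemma polyAverage_eq_cesaro (p : Fin d → ℤ[X]) (f : Lp ℂ 2 μ) (N : ℕ) :
    polyAverage μ p f N
      = cesaro (fun n : ℕ => koopman μ (polyMap (fun i => (p i).comp (Polynomial.X + 1)) n) f) N := by
  rw [polyAverage, cesaro, one_div]
  congr 1
  rw [← Finset.Ico_add_one_right_eq_Icc, Finset.sum_Ico_eq_sum_range]
  refine Finset.sum_congr (by simp) fun n _ => ?_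
  congr 2
  ext i
  simp [polyMap, add_comm]

/-- Polynomial averages converge, and for polynomials with values in `k ℤ^d`, where `k` depends only
on `f` and `ε`, the limit is `ε`-close to the projection to the rational Kronecker factor. -/
theorem exists_tendsto_polyAverage_near_projRat (f : Lp ℂ 2 μ) {ε : ℝ} (hε : 0 < ε) :
    ∃ k : ℕ, 0 < k ∧ ∀ p : Fin d → ℤ[X], NoConstantCombination p →
      ∃ Q : Lp ℂ 2 μ, Tendsto (polyAverage μ p f) atTop (𝓝 Q) ∧
        ((∀ n : ℤ, ∃ w : Fin d → ℤ, polyMap p n = (k : ℤ) • w) → ‖Q - projRat d μ f‖ < ε) := by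
  have hU := isIsometricAction_koopman (d := d) μ
  set f₁ := projRat d μ f with hf₁
  have hmem : f₁ ∈ ratKronecker d μ := Submodule.starProjection_apply_mem _ f
  obtain ⟨k, hk, g, hg, hfg⟩ := exists_periodic_near_of_mem_ratKronecker μ hmem
    (show 0 < ε / 3 by positivity)
  refine ⟨k, hk, fun p hp => ?_⟩
  set q : Fin d → ℤ[X] := fun i => (p i).comp (Polynomial.X + 1) with hq
  have hzero : Tendsto (cesaro fun n : ℕ => koopman μ (polyMap q n) (f - f₁))
      atTop (𝓝 0) := by
    refine hU.tendsto_cesaro_polyMap_of_orthogonal_periodic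
      (Finset.univ.sup fun i => (q i).natDegree) _ q
      (fun i => Finset.le_sup (f := fun i => (q i).natDegree) (Finset.mem_univ i))
      (fun M hM y hy => ?_) fun c _ hc => ?_
    · refine Submodule.starProjection_inner_eq_zero f y ?_
      lift M to ℕ using hM.le
      exact mem_ratKronecker_of_periodic μ (by exact_mod_cast hM) hy
    · by_contra hne
      obtain ⟨b, hb⟩ := isConstantCombination_of_comp (p := p) (M := 1) one_ne_zero 1
        (by simpa using hc)
      exact hp c hne b hb
  obtain ⟨Q, hQ⟩ : ∃ Q, Tendsto (cesaro fun n : ℕ => koopman μ (polyMap q n) f₁)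
      atTop (𝓝 Q) := by
    refine exists_tendsto_cesaro_of_approx fun δ hδ => ?_
    obtain ⟨M, hM, g', hg', hfg'⟩ := exists_periodic_near_of_mem_ratKronecker μ hmem hδ
    refine ⟨_, fun n => ?_, hU.exists_tendsto_cesaro_polyMap_of_periodic q hM hg'⟩
    rw [← map_sub, LinearIsometry.norm_map]
    exact hfg'.le
  refine ⟨Q, ?_, fun hpk => ?_⟩
  · have := hzero.add hQ
    rw [zero_add] at this
    refine this.congr fun N => ?_
    rw [← cesaro_add, polyAverage_eq_cesaro]
    simp only [← map_add, sub_add_cancel, hq]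
  · have hlim := (hQ.sub (tendsto_cesaro_const f₁)).norm
    -- Limits preserve only weak inequalities; the spare `ε / 3` restores strictness.
    refine lt_of_le_of_lt (b := ε / 3 + ε / 3) (le_of_tendsto' hlim fun N => ?_) (by linarith)
    rw [← cesaro_sub]
    refine norm_cesaro_le (fun n => ?_) N
    obtain ⟨w, hw⟩ := hpk (n + 1)
    have hqg : koopman μ (polyMap q n) g = g := by
      have e : polyMap q n = polyMap p (n + 1) := by
        ext i
        simp [hq, polyMap]
      rw [e, hw, hg]
    calc ‖koopman μ (polyMap q n) f₁ - f₁‖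
        = ‖koopman μ (polyMap q n) (f₁ - g) - (f₁ - g)‖ := by
          rw [map_sub, hqg]
          congr 1
          abel
      _ ≤ ‖koopman μ (polyMap q n) (f₁ - g)‖ + ‖f₁ - g‖ := norm_sub_le _ _
      _ ≤ ε / 3 + ε / 3 := by
          rw [LinearIsometry.norm_map]
          linarith

end Koopman

end PolynomialErgodic

theorem proposition3p3 {d : ℕ} {X : Type*} [MeasurableSpace X] [AddAction (Fin d → ℤ) X]
    [MeasurableConstVAdd (Fin d → ℤ) X] (μ : Measure X)
    [VAddInvariantMeasure (Fin d → ℤ) X μ] (f : Lp ℂ 2 μ) (ε : ℝ) (hε : 0 < ε) :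
    ∃ k : ℕ, 0 < k ∧ ∀ p : Fin d → Polynomial ℤ,
      PolynomialErgodic.NoConstantCombination p →
        ∃ Q : Lp ℂ 2 μ,
          Filter.Tendsto (PolynomialErgodic.polyAverage μ p f) Filter.atTop (nhds Q) ∧
          ((∀ n : ℤ, ∃ w : Fin d → ℤ, PolynomialErgodic.polyMap p n = (k : ℤ) • w) →
            ‖Q - PolynomialErgodic.projRat d μ f‖ < ε) :=
  PolynomialErgodic.exists_tendsto_polyAverage_near_projRat μ f hε
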